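/- **Setting.** Let $N$ be a free abelian group of finite rank $n$, $M_{\mathbb Q}=\mathbb Q\otimes\operatorname{Hom}(N,\mathbb Z)$, $N_{\mathbb Q}=\mathbb Q\otimes N$, with pairing $\langle\cdot,\cdot\rangle$. Let $\Sigma$ be a fan in $N_{\mathbb Q}$ (a finite nonempty collection of strongly convex rational polyhedral cones, closed under faces, any two meeting in a common face), and $X$ its toric variety. For $\sigma\in\Sigma$ let $N_\sigma$ be the subgroup of $N$ generated by $\sigma\cap N$, let $\sigma^\perp=\{u\in M_{\mathbb Q}:\langle u,x\rangle=0\ \text{for all } x\in\sigma\}$ and $\sigma^\vee=\{u\in M_{\mathbb Q}:\langle u,x\rangle\ge 0\ \text{for all } x\in\sigma\}$. A $\mathbb Q$-Cartier divisor $D$ is a family of local equations $m_\sigma\in M_{\mathbb Q}/\sigma^\perp$, $\sigma\in\Sigma$, such that $m_\sigma\mapsto m_\tau$ whenever $\tau$ is a face of $\sigma$. Let $Z_*(X)_{\mathbb Q}$ be the $\mathbb Q$-vector space with basis the symbols $[V(\sigma)]$, $\sigma\in\Sigma$, and let $[X]=[V(\{0\})]$. Let $0=L_0\subsetneq L_1\subsetneq\dots\subsetneq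 L_n=M_{\mathbb Q}$ be a complete flag which is generic for $\Sigma$: $\sigma^\perp\cap L_k=0$ for every $k$-dimensional $\sigma\in\Sigma$. Put $\Psi(\sigma)=L_{\dim\sigma}$, so $M_{\mathbb Q}=\sigma^\perp\oplus\Psi(\sigma)$. If $\sigma$ is a facet of $\tau$, let $\pi_\sigma:M_{\mathbb Q}/\tau^\perp\to\sigma^\perp/\tau^\perp$ be induced by the projection of $M_{\mathbb Q}$ onto $\sigma^\perp$ along $\Psi(\sigma)$, and let $n_{\tau,\sigma}\in N_\tau/N_\sigma$ be the first lattice point along the ray of $N/N_\sigma$ which is the image of $\tau$. A divisor $D$ acts linearly on $Z_*(X)_{\mathbb Q}$ by $$D\cdot[V(\sigma)]=\sum_{\tau\,:\,\sigma\text{ is a facet of }\tau}\langle\pi_\sigma(m_\tau),n_{\tau,\sigma}\rangle\,[V(\tau)],$$ and $D^n$ denotes $D\cdot D\cdots D\cdot[X]$ ($n$ factors $D$). **Theorem.** Let $\sigma\in\Sigma$ be an $n$-dimensional simplicial cone with facets $\tau_1,\dots,\tau_n$, and let $D$ be a $\mathbb Q$-Cartier divisor with local equation $m\in M_{\mathbb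 Q}$ on $\sigma$. Let $w\in N_{\mathbb Q}$ be a nonzero vector perpendicular to $L_{n-1}$. For $1\le i\le n$ choose $t_i\in\tau_i^*=\tau_i^\perp\cap\sigma^\vee$ such that the simplex with vertices $0,t_1,\dots,t_n$ has lattice volume $\frac1{n!}$, where the lattice volume of the simplex with vertices $u_0,\dots,u_n$ is $\frac1{n!}\bigl|\det(\langle u_j-u_0,v_i\rangle)_{1\le i,j\le n}\bigr|$ for a basis $v_1,\dots,v_n$ of $N$. Then all $\langle t_i,w\rangle$ are nonzero, and the coefficient of $[V(\sigma)]$ in $D^n$ is $$\frac{\langle m,w\rangle^n}{\langle t_1,w\rangle\cdots\langle t_n,w\rangle}.$$ -/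

import Mathlib

noncomputable section

namespace ToricCycle

open Module

section Lattice

variable (N : Type*) [AddCommGroup N]

/-- The rational vector space `ℚ ⊗ N` of a lattice `N`. -/
abbrev NQ : Type _ := TensorProduct ℤ ℚ N

/-- The rational vector space `M_ℚ = ℚ ⊗ Hom(N, ℤ)`, realised as the `ℚ`-linear dual of `ℚ ⊗ N`
(for `N` free of finite rank the two are canonically isomorphic). The duality pairing `⟨u, x⟩`
is evaluation `u x`. -/
abbrev MQ : Type _ := Module.Dual ℚ (NQ N)

/-- The inclusion `N → ℚ ⊗ N`, `x ↦ 1 ⊗ x`. -/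
def incl : N →ₗ[ℤ] NQ N := TensorProduct.mk ℤ ℚ N 1

end Lattice

section Cones

variable {N : Type*} [AddCommGroup N]

/-- The linear span of a cone in `ℚ ⊗ N`. -/
def linSpan (σ : PointedCone ℚ (NQ N)) : Submodule ℚ (NQ N) :=
  Submodule.span ℚ (σ : Set (NQ N))

/-- The dimension of a cone. -/
def dim (σ : PointedCone ℚ (NQ N)) : ℕ := finrank ℚ (linSpan σ)

/-- `M(σ)_ℚ = σ^⊥`, the elements of `M_ℚ` that vanish on `σ`. -/
def perp (σ : PointedCone ℚ (NQ N)) : Submodule ℚ (MQ N) :=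
  (linSpan σ).dualAnnihilator

/-- `N_σ`, the subgroup of `N` generated by the lattice points of `σ`. -/
def latSpan (σ : PointedCone ℚ (NQ N)) : Submodule ℤ N :=
  Submodule.span ℤ {x : N | incl N x ∈ σ}

/-- `τ` is a facet (maximal proper face) of `σ`. -/
def IsFacet (τ σ : PointedCone ℚ (NQ N)) : Prop :=
  τ.IsFaceOf σ ∧ τ ≠ σ ∧
    ∀ γ : PointedCone ℚ (NQ N), γ.IsFaceOf σ → γ ≠ σ → τ ≤ γ → γ = τ

/-- `τ^* = τ^⊥ ∩ σ^∨`, the set of elements of `M_ℚ` that vanish on `τ` and are nonnegative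
on `σ`. -/
def starCone (τ σ : PointedCone ℚ (NQ N)) : Set (MQ N) :=
  {u | u ∈ perp τ ∧ ∀ x ∈ σ, 0 ≤ u x}

/-- `M(σ)_τ = M(σ) / M(τ)`, tensored with `ℚ`. -/
abbrev RelM (σ τ : PointedCone ℚ (NQ N)) : Type _ :=
  ↥(perp σ) ⧸ (perp τ).submoduleOf (perp σ)

/-- `N(σ)_τ = N_τ / N_σ` (an honest quotient of lattices, not tensored). -/
abbrev RelN (σ τ : PointedCone ℚ (NQ N)) : Type _ :=
  ↥(latSpan τ) ⧸ (latSpan σ).submoduleOf (latSpan τ)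

theorem mem_perp {σ : PointedCone ℚ (NQ N)} {u : MQ N} : u ∈ perp σ ↔ ∀ x ∈ σ, u x = 0 := by
  rw [perp, Submodule.mem_dualAnnihilator]
  constructor
  · intro h x hx
    exact h x (Submodule.subset_span hx)
  · intro h x hx
    have hle : linSpan σ ≤ LinearMap.ker u := Submodule.span_le.2 fun y hy => h y hy
    exact hle hx

theorem perp_anti {σ τ : PointedCone ℚ (NQ N)} (h : σ ≤ τ) : perp τ ≤ perp σ :=
  fun _ hu => mem_perp.2 fun x hx => mem_perp.1 hu x (h hx)

theorem apply_latSpan {σ : PointedCone ℚ (NQ N)} {u : MQ N} (hu : u ∈ perp σ) {x : N}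
    (hx : x ∈ latSpan σ) : u (incl N x) = 0 := by
  have hle : latSpan σ ≤ LinearMap.ker ((u.restrictScalars ℤ) ∘ₗ incl N) :=
    Submodule.span_le.2 fun y hy => mem_perp.1 hu _ hy
  exact hle hx

/-- The duality pairing `M(σ)_τ × N(σ)_τ → ℚ` induced by the pairing of `M` and `N`. -/
def pairing (σ τ : PointedCone ℚ (NQ N)) : RelM σ τ →ₗ[ℚ] (RelN σ τ →ₗ[ℤ] ℚ) :=
  ((perp τ).submoduleOf (perp σ)).liftQ
    { toFun := fun u =>
        ((latSpan σ).submoduleOf (latSpan τ)).liftQ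
          (((u : MQ N).restrictScalars ℤ) ∘ₗ incl N ∘ₗ (latSpan τ).subtype)
          (fun x hx => apply_latSpan u.2 hx)
      map_add' := fun u v => by
        apply Submodule.linearMap_qext
        ext x
        rfl
      map_smul' := fun c u => by
        apply Submodule.linearMap_qext
        ext x
        rfl }
    (fun u hu => by
      rw [LinearMap.mem_ker]
      apply Submodule.linearMap_qext
      ext x
      exact apply_latSpan (σ := τ) hu x.2)

theorem pairing_mk (σ τ : PointedCone ℚ (NQ N)) (u : perp σ) (x : latSpan τ) :
    pairing σ τ (Submodule.Quotient.mk u) (Submodule.Quotient.mk x) =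
      (u : MQ N) (incl N (x : N)) := rfl

/-- The image in `N(σ)_τ` of the lattice points of `τ`. If `σ` is a facet of `τ`, these are the
lattice points of `N(σ)` on the ray that is the image of `τ`. -/
def rayPoints (σ τ : PointedCone ℚ (NQ N)) : Set (RelN σ τ) :=
  {p | ∃ (x : N) (hx : incl N x ∈ τ),
    p = Submodule.Quotient.mk (⟨x, Submodule.subset_span hx⟩ : latSpan τ)}

/-- `p` is the first lattice point along the ray that is the image of `τ`: the lattice points on
that ray are exactly the natural multiples of `p`. -/
def IsFirstPoint (σ τ : PointedCone ℚ (NQ N)) (p : RelN σ τ) : Prop :=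
  rayPoints σ τ = Set.range fun k : ℕ => k • p

open Classical in
/-- `n_{τ,σ}`, the first lattice point of `N(σ)` along the image of `τ`, for `σ` a facet of `τ`
(and `0` if there is no such point, which does not happen for a facet of a rational polyhedral
cone). -/
def normalGen (σ τ : PointedCone ℚ (NQ N)) : RelN σ τ :=
  if h : ∃ p, IsFirstPoint σ τ p then h.choose else 0

end Cones

section Fans

variable (N : Type*) [AddCommGroup N]

/-- A fan in `ℚ ⊗ N`: a finite collection of strongly convex rational polyhedral cones that
contains the zero cone (i.e. is not empty), is closed under faces, and in which any two cones meet
in a common face. A polyhedral cone in `ℚ ⊗ N` is automatically rational. -/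
structure Fan where
  cones : Finset (PointedCone ℚ (NQ N))
  fg : ∀ σ ∈ cones, Submodule.FG σ
  salient : ∀ σ ∈ cones, (σ : ConvexCone ℚ (NQ N)).Salient
  bot_mem : ⊥ ∈ cones
  face_mem : ∀ σ ∈ cones, ∀ τ : PointedCone ℚ (NQ N), τ.IsFaceOf σ → τ ∈ cones
  inter_face : ∀ σ ∈ cones, ∀ τ ∈ cones, (σ ⊓ τ).IsFaceOf σ ∧ (σ ⊓ τ).IsFaceOf τ

variable {N}

/-- The cones of a fan, as a type. -/
abbrev Fan.Cone (Δ : Fan N) : Type _ := {σ : PointedCone ℚ (NQ N) // σ ∈ Δ.cones}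

/-- A `ℚ`-Cartier divisor on the toric variety of `Δ`, given by its local equations
`m_σ ∈ M_σ = M / M(σ)` (tensored with `ℚ`), which agree on faces. -/
structure QCartier (Δ : Fan N) where
  localEq : ∀ σ : Δ.Cone, MQ N ⧸ perp σ.1
  compat : ∀ (τ σ : Δ.Cone) (h : τ.1.IsFaceOf σ.1),
    Submodule.factor (perp_anti h.le) (localEq σ) = localEq τ

/-- A choice of complements for `Δ`: subspaces `Ψ(σ)` of `M_ℚ` complementary to `σ^⊥`, with
`Ψ(τ) ⊆ Ψ(σ)` for `τ` a face of `σ`. -/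
structure Complements (Δ : Fan N) where
  Ψ : Δ.Cone → Submodule ℚ (MQ N)
  isCompl : ∀ σ : Δ.Cone, IsCompl (perp σ.1) (Ψ σ)
  mono : ∀ τ σ : Δ.Cone, τ.1.IsFaceOf σ.1 → Ψ τ ≤ Ψ σ

/-- The invariant cycles of the toric variety of `Δ` with rational coefficients: the vector space
with basis the symbols `[V(σ)]`, `σ ∈ Δ`. The coefficient of `[V(σ)]` in `z` is `z σ`. -/
abbrev Cycles (Δ : Fan N) : Type _ := Δ.Cone →₀ ℚ

/-- The basis element `[V(σ)]`. -/
def orbitCycle (Δ : Fan N) (σ : Δ.Cone) : Cycles Δ := Finsupp.single σ 1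

/-- The cycle `[X] = [V({0})]` of the whole toric variety. -/
def fundamentalCycle (Δ : Fan N) : Cycles Δ := orbitCycle Δ ⟨⊥, Δ.bot_mem⟩

variable {Δ : Fan N}

/-- The map `π_σ : M_τ → M(σ)_τ` induced by the projection of `M` onto `M(σ)` along `Ψ(σ)`, for
`σ ⊆ τ`. -/
def Complements.proj (C : Complements Δ) (σ τ : Δ.Cone) (h : σ.1 ≤ τ.1) :
    (MQ N ⧸ perp τ.1) →ₗ[ℚ] RelM σ.1 τ.1 :=
  (perp τ.1).mapQ ((perp τ.1).submoduleOf (perp σ.1))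
    ((perp σ.1).projectionOnto (C.Ψ σ) (C.isCompl σ))
    (fun u hu => by
      have hu' : u ∈ perp σ.1 := perp_anti h hu
      have key : (perp σ.1).projectionOnto (C.Ψ σ) (C.isCompl σ) u = ⟨u, hu'⟩ :=
        Submodule.projectionOnto_apply_left (C.isCompl σ) ⟨u, hu'⟩
      rw [Submodule.mem_comap, key]
      exact hu)

open Classical in
/-- `D · [V(σ)] = ∑ ⟨π_σ(m_τ), n_{τ,σ}⟩ [V(τ)]`, the sum being over the cones `τ` of the fan of
which `σ` is a facet. -/
def Complements.actOn (C : Complements Δ) (D : QCartier Δ) (σ : Δ.Cone) : Cycles Δ :=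
  ∑ τ : Δ.Cone,
    if h : IsFacet σ.1 τ.1 then
      pairing σ.1 τ.1 (C.proj σ τ h.1.le (D.localEq τ)) (normalGen σ.1 τ.1) • orbitCycle Δ τ
    else 0

/-- The action `z ↦ D · z` of a `ℚ`-Cartier divisor on cycles, extended linearly. -/
def Complements.act (C : Complements Δ) (D : QCartier Δ) : Module.End ℚ (Cycles Δ) :=
  Finsupp.linearCombination ℚ (C.actOn D)

/-- The cycle `D^k = D · D ⋯ D · [X]` (`k` factors `D`). -/
def Complements.power (C : Complements Δ) (D : QCartier Δ) (k : ℕ) : Cycles Δ :=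
  (C.act D ^ k) (fundamentalCycle Δ)

end Fans

section Flags

variable (N : Type*) [AddCommGroup N]

/-- A complete flag `0 = L_0 < L_1 < ⋯ < L_n = M_ℚ`, where `n` is the rank of `N`. -/
structure CompleteFlag where
  L : Fin (finrank ℤ N + 1) → Submodule ℚ (MQ N)
  strictMono : StrictMono L
  bot : L 0 = ⊥
  top : L (Fin.last _) = ⊤

variable {N} [Module.Finite ℤ N]

theorem CompleteFlag.le_finrank (F : CompleteFlag N) :
    ∀ (k : ℕ) (hk : k < finrank ℤ N + 1), k ≤ finrank ℚ (F.L ⟨k, hk⟩) := by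
  intro k
  induction k with
  | zero => intro hk; exact Nat.zero_le _
  | succ k ih =>
    intro hk
    have h1 := ih (Nat.lt_of_succ_lt hk)
    have h2 : F.L ⟨k, Nat.lt_of_succ_lt hk⟩ < F.L ⟨k + 1, hk⟩ :=
      F.strictMono (by simp [Fin.lt_def])
    have h3 := Submodule.finrank_lt_finrank_of_lt h2
    omega

variable [Module.Free ℤ N]

theorem dim_le (σ : PointedCone ℚ (NQ N)) : dim σ ≤ finrank ℤ N := by
  have h := Submodule.finrank_le (linSpan σ)
  rwa [Module.finrank_baseChange] at h

/-- The flag is generic with respect to `Δ`: `σ^⊥ ∩ L_k = 0` for every `k`-dimensional cone `σ`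
of `Δ`. -/
def CompleteFlag.IsGeneric (F : CompleteFlag N) (Δ : Fan N) : Prop :=
  ∀ σ ∈ Δ.cones, perp σ ⊓ F.L ⟨dim σ, Nat.lt_succ_of_le (dim_le σ)⟩ = ⊥

theorem CompleteFlag.isCompl (F : CompleteFlag N) {Δ : Fan N} (hF : F.IsGeneric Δ) (σ : Δ.Cone) :
    IsCompl (perp σ.1) (F.L ⟨dim σ.1, Nat.lt_succ_of_le (dim_le σ.1)⟩) := by
  refine ((Submodule.isCompl_iff_disjoint _ _ ?_).2 (disjoint_iff.2 (hF σ.1 σ.2)))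
  have h1 := F.le_finrank (dim σ.1) (Nat.lt_succ_of_le (dim_le σ.1))
  have h2 : finrank ℚ (linSpan σ.1) + finrank ℚ (perp σ.1) = finrank ℚ (NQ N) :=
    Subspace.finrank_add_finrank_dualAnnihilator_eq (linSpan σ.1)
  rw [Subspace.dual_finrank_eq, ← h2, add_comm]
  exact Nat.add_le_add_left h1 _

/-- The choice of complements `Ψ(σ) = L_{dim σ}` given by a generic flag. -/
def CompleteFlag.complements (F : CompleteFlag N) {Δ : Fan N} (hF : F.IsGeneric Δ) :
    Complements Δ where
  Ψ := fun σ => F.L ⟨dim σ.1, Nat.lt_succ_of_le (dim_le σ.1)⟩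
  isCompl := F.isCompl hF
  mono := fun _ _ h =>
    F.strictMono.monotone (Submodule.finrank_mono (Submodule.span_mono h.le))

/-- The lattice volume `|det A| / n!` of the simplex in `M_ℚ` with vertices `u_0, …, u_n`, where
`A_{ij} = ⟨u_j - u_0, v_i⟩` for a basis `v_1, …, v_n` of the lattice `N`. -/
def latticeVolume (u : Fin (finrank ℤ N + 1) → MQ N) : ℚ :=
  |(Matrix.of fun i j : Fin (finrank ℤ N) =>
      (u j.succ - u 0) (incl N (Module.finBasis ℤ N i))).det| / ((finrank ℤ N).factorial : ℚ)

end Flags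

end ToricCycle

end

/-! The cone is spanned by a basis `e` of lattice points, and its faces correspond to subsets `S` of
the index set. Only these faces affect the coefficient, since a facet of a face is again one of
them. Write `w_i` for the coordinates of `w`. Multiplying the coefficient of the face of `S` in `D ^
|S|` by the index `mult S` of the lattice spanned by the `e i`, `i ∈ S`, gives a number `c S`. The
normal generator at `i` is `a e_i` modulo the opposite facet, and `a * mult S = mult (S \ i)`. So
the lattice drops out: `c S = ∑ i ∈ S, c (S \ i) * p S i`, where `p S i` is the value at `e i` of
the projection of `m` (`Complements.power_mul_mult`).

If `w` lies in the span of `S` and is killed by `L_{|S|-1}`, then `p S i * w_i = m w`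
(`CompleteFlag.edgeValue_mul_coord`). The claim, by induction on `S`, is `c S * ∏ w_i = m w ^ |S|`
(`IsTransverse.chain_sum_eq`). Pick a second vector `v` in the span of `S` killed by `L_{|S|-2}`.
Then `w_i v - v_i w` is a vector of the same kind as `w` for `S \ i`, so the induction hypothesis
evaluates `c (S \ i)`. In the ratios `r_i = v_i / w_i` the sum becomes the Lagrange formula for the
leading coefficient of `(m v - m w * X) ^ (|S| - 1)`.

For the whole cone, `t_i` is `t_i (e i)` times the `i`-th coordinate function, and the volume
condition says that `∏ t_i (e i)` is the multiplicity. Hence the multiplicity and the coordinates of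
`w` combine into `∏ t_i w`. -/

noncomputable section

namespace ToricCycle

open Module

/-! ### Leading coefficients by Lagrange interpolation. -/

section Interpolation

/-- The leading coefficient of `(y - x r) ^ k`, interpolated at `k + 1` nodes. -/
theorem sum_pow_div_prod_sub {ι K : Type*} [DecidableEq ι] [Field K] {S : Finset ι}
    (hS : S.Nonempty) {r : ι → K} (hr : Set.InjOn r S) (x y : K) :
    ∑ i ∈ S, (y - x * r i) ^ (S.card - 1) / ∏ j ∈ S.erase i, (r i - r j) =
      (-x) ^ (S.card - 1) := by
  have hpos := hS.card_pos
  have hdeg : (Polynomial.C (-x) * Polynomial.X + Polynomial.C y).natDegree ≤ 1 :=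
    Polynomial.natDegree_linear_le
  have hlt : ((Polynomial.C (-x) * Polynomial.X + Polynomial.C y) ^ (S.card - 1)).degree <
      (S.card : WithBot ℕ) := by
    refine lt_of_le_of_lt (Polynomial.degree_le_natDegree) ?_
    have := Polynomial.natDegree_pow_le_of_le (S.card - 1) hdeg
    exact_mod_cast (by omega)
  -- `(y - x X) ^ (|S| - 1)` has degree below the number of nodes, so its coefficient in degree `|S|
  -- - 1` is the interpolation sum.
  have h := Lagrange.coeff_eq_sum hr hlt
  have hc := Polynomial.coeff_pow_of_natDegree_le (m := S.card - 1) hdeg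
  rw [mul_one] at hc
  rw [hc] at h
  simp only [Polynomial.coeff_add, Polynomial.coeff_C_mul, Polynomial.coeff_X_one, mul_one,
    Polynomial.coeff_C, one_ne_zero, if_false, add_zero, Polynomial.eval_pow,
    Polynomial.eval_add, Polynomial.eval_mul, Polynomial.eval_C, Polynomial.eval_X] at h
  rw [h]
  refine Finset.sum_congr rfl fun i _ => ?_
  congr 2
  ring

end Interpolation

/-! ### Linear algebra of the recursion over subsets of a basis. -/

section Recursion

variable {V ι : Type*} [AddCommGroup V] [Module ℚ V]

/-- The span of the basis vectors with index in `S`. -/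
def coordSub (e : Basis ι ℚ V) (S : Finset ι) : Submodule ℚ V where
  carrier := {x | ∀ j ∉ S, e.coord j x = 0}
  zero_mem' := fun _ _ => map_zero _
  add_mem' := fun hx hy j hj => by rw [map_add, hx j hj, hy j hj, add_zero]
  smul_mem' := fun c x hx j hj => by rw [map_smul, hx j hj, smul_zero]

theorem mem_coordSub {e : Basis ι ℚ V} {S : Finset ι} {x : V} :
    x ∈ coordSub e S ↔ ∀ j ∉ S, e.coord j x = 0 := Iff.rfl

theorem mem_coordSub_erase [DecidableEq ι] {e : Basis ι ℚ V} {S : Finset ι} {i : ι} {x : V}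
    (hx : x ∈ coordSub e S) (hi : e.coord i x = 0) : x ∈ coordSub e (S.erase i) := by
  intro j hj
  rcases eq_or_ne j i with rfl | hne
  · exact hi
  · exact hx j fun h => hj (Finset.mem_erase.2 ⟨hne, h⟩)

theorem coordSub_mono {e : Basis ι ℚ V} {S T : Finset ι} (h : S ⊆ T) :
    coordSub e S ≤ coordSub e T :=
  fun _ hx j hj => hx j fun hjS => hj (h hjS)

theorem coordSub_empty (e : Basis ι ℚ V) : coordSub e ∅ = ⊥ := by
  refine (Submodule.eq_bot_iff _).2 fun x hx => ?_
  exact e.ext_elem fun i => by simpa using hx i (by simp)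

theorem basis_mem_coordSub (e : Basis ι ℚ V) {S : Finset ι} {i : ι} (hi : i ∈ S) :
    e i ∈ coordSub e S := by
  intro j hj
  rw [Basis.coord_apply, e.repr_self, Finsupp.single_eq_of_ne]
  rintro rfl
  exact hj hi

variable [DecidableEq ι]
variable (e : Basis ι ℚ V) (L : ℕ → Submodule ℚ (Dual ℚ V))

/-- A filtration of the dual space that meets the annihilator of `coordSub e S` in `0` in
degree `S.card`, phrased dually. -/
def IsTransverse : Prop :=
  ∀ (S : Finset ι) (x : V), x ∈ coordSub e S → (∀ u ∈ L S.card, u x = 0) → x = 0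

variable {e L}

/-- A vanishing coordinate would move `w` into the span of one basis vector fewer, where
transversality in degree `|S| - 1` forces `w = 0`. -/
theorem IsTransverse.coord_ne_zero (hU : IsTransverse e L) {S : Finset ι} {w : V}
    (hw : w ≠ 0) (hwS : w ∈ coordSub e S) (hwL : ∀ u ∈ L (S.card - 1), u w = 0) :
    ∀ i ∈ S, e.coord i w ≠ 0 := by
  intro i hi h0
  refine hw (hU (S.erase i) w (mem_coordSub_erase hwS h0) ?_)
  rwa [Finset.card_erase_of_mem hi]

/-- Take `v` to be the normal vector of `S` minus one index `l`. The combination vanishes at `i`. If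
it also vanished at `j`, it would lie in the span of `|S| - 2` basis vectors and be killed by `L
(|S| - 2)`, hence be zero. The nonvanishing at distinct indices makes the ratios of coordinates
distinct nodes. -/
theorem IsTransverse.exists_second_vector (hU : IsTransverse e L) (hL : Monotone L)
    (hE : ∀ S : Finset ι, ∃ v ∈ coordSub e S, (∀ u ∈ L (S.card - 1), u v = 0) ∧
      ∀ i ∈ S, e.coord i v ≠ 0)
    {S : Finset ι} (hS : S.Nonempty) {w : V} (hwS : w ∈ coordSub e S)
    (hwL : ∀ u ∈ L (S.card - 1), u w = 0) (hw : ∀ i ∈ S, e.coord i w ≠ 0) :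
    ∃ v ∈ coordSub e S, (∀ u ∈ L (S.card - 1 - 1), u v = 0) ∧
      ∀ i ∈ S, ∀ j ∈ S, i ≠ j → e.coord j (e.coord i w • v - e.coord i v • w) ≠ 0 := by
  obtain ⟨l, hl⟩ := hS
  obtain ⟨v, hv, hvL, hv0⟩ := hE (S.erase l)
  rw [Finset.card_erase_of_mem hl] at hvL
  refine ⟨v, coordSub_mono (S.erase_subset l) hv, hvL, fun i hi j hj hij h0 => ?_⟩
  have hvl : e.coord l v = 0 := hv l (by simp)
  have hx : e.coord i w • v - e.coord i v • w ∈ coordSub e ((S.erase i).erase j) := by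
    refine mem_coordSub_erase (mem_coordSub_erase ?_ ?_) h0
    · exact Submodule.sub_mem _ (Submodule.smul_mem _ _ (coordSub_mono (S.erase_subset l) hv))
        (Submodule.smul_mem _ _ hwS)
    · simp only [map_sub, map_smul, smul_eq_mul]
      ring
  have hzero := hU _ _ hx (fun u hu => by
    rw [Finset.card_erase_of_mem (Finset.mem_erase.2 ⟨hij.symm, hj⟩),
      Finset.card_erase_of_mem hi] at hu
    rw [map_sub, map_smul, map_smul, hvL u hu, hwL u (hL (by omega) hu)]
    simp)
  -- Since `v_l = 0`, the `l`-th coordinate of the zero vector is `-v_i w_l`, which is nonzero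
  -- unless `i = l`. In that remaining case the `j`-th coordinate `w_l v_j` gives the contradiction.
  have hil : i = l := by
    by_contra hne
    have := congrArg (e.coord l) hzero
    simp only [map_sub, map_smul, hvl, smul_eq_mul, mul_zero, zero_sub, map_zero,
      neg_eq_zero, mul_eq_zero] at this
    exact this.elim (hv0 i (Finset.mem_erase.2 ⟨hne, hi⟩)) (hw l hl)
  subst hil
  have hj' := hv0 j (Finset.mem_erase.2 ⟨hij.symm, hj⟩)
  simp only [map_sub, map_smul, hvl, smul_eq_mul, zero_mul, sub_zero, mul_eq_zero] at h0
  exact h0.elim (hw i hi) hj'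

/-- The sum over chains of subsets, evaluated by Lagrange interpolation in the plane of vectors
killed by `L (S.card - 2)`. -/
theorem IsTransverse.chain_sum_eq (hU : IsTransverse e L) (hL : Monotone L)
    (hE : ∀ S : Finset ι, ∃ v ∈ coordSub e S, (∀ u ∈ L (S.card - 1), u v = 0) ∧
      ∀ i ∈ S, e.coord i v ≠ 0)
    {m : Dual ℚ V} {c : Finset ι → ℚ} {p : Finset ι → ι → ℚ} (hc0 : c ∅ = 1)
    (hc : ∀ S : Finset ι, S.Nonempty → c S = ∑ i ∈ S, c (S.erase i) * p S i)
    (hp : ∀ (S : Finset ι), ∀ i ∈ S, ∀ w ∈ coordSub e S, (∀ u ∈ L (S.card - 1), u w = 0) →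
      p S i * e.coord i w = m w)
    (S : Finset ι) : ∀ w ∈ coordSub e S, (∀ u ∈ L (S.card - 1), u w = 0) →
      (∀ i ∈ S, e.coord i w ≠ 0) → c S * ∏ i ∈ S, e.coord i w = m w ^ S.card := by
  induction S using Finset.strongInduction with
  | H S ih =>
  intro w hwS hwL hw
  rcases S.eq_empty_or_nonempty with rfl | hS
  · simp [hc0]
  obtain ⟨v, hvS, hvL, hv⟩ := hU.exists_second_vector hL hE hS hwS hwL hw
  set a : ι → ℚ := fun i => e.coord i w
  set b : ι → ℚ := fun i => e.coord i v
  set r : ι → ℚ := fun i => b i / a i with hrdef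
  have ha : ∀ i ∈ S, a i ≠ 0 := hw
  have hne : ∀ i ∈ S, ∀ j ∈ S, i ≠ j → a i * b j - b i * a j ≠ 0 := fun i hi j hj hij => by
    simpa [a, b] using hv i hi j hj hij
  have hr : Set.InjOn r S := by
    intro i hi j hj hij
    by_contra hij'
    apply hne i hi j hj hij'
    rw [hrdef] at hij
    dsimp only at hij
    rw [div_eq_div_iff (ha i hi) (ha j hj)] at hij
    linarith
  -- After multiplication by `∏ a_j`, each summand is a constant times a Lagrange term at the node
  -- `r i`.
  have hterm : ∀ i ∈ S, c (S.erase i) * p S i * ∏ j ∈ S, a j =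
      m w * (-1) ^ (S.card - 1) *
        ((m v - m w * r i) ^ (S.card - 1) / ∏ j ∈ S.erase i, (r i - r j)) := by
    intro i hi
    have hIH := ih (S.erase i) (Finset.erase_ssubset hi) (a i • v - b i • w)
      (mem_coordSub_erase (Submodule.sub_mem _ (Submodule.smul_mem _ _ hvS)
        (Submodule.smul_mem _ _ hwS)) (by simp only [map_sub, map_smul, smul_eq_mul, a, b]; ring))
      (fun u hu => by
        rw [Finset.card_erase_of_mem hi] at hu
        rw [map_sub, map_smul, map_smul, hvL u hu, hwL u (hL (by omega) hu)]
        simp)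
      (fun j hj => hv i hi j (Finset.mem_of_mem_erase hj) (Finset.ne_of_mem_erase hj).symm)
    rw [Finset.card_erase_of_mem hi] at hIH
    -- Factor by factor, `a_i b_j - b_i a_j = -a_i a_j (r_i - r_j)`.
    have hprod : ∏ j ∈ S.erase i, e.coord j (a i • v - b i • w) =
        (-1) ^ (S.card - 1) * a i ^ (S.card - 1) * (∏ j ∈ S.erase i, a j) *
          ∏ j ∈ S.erase i, (r i - r j) := by
      rw [← Finset.card_erase_of_mem hi, ← Finset.prod_const, ← Finset.prod_const,
        ← Finset.prod_mul_distrib, ← Finset.prod_mul_distrib, ← Finset.prod_mul_distrib]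
      refine Finset.prod_congr rfl fun j hj => ?_
      have h1 := ha i hi
      have h2 := ha j (Finset.mem_of_mem_erase hj)
      simp only [map_sub, map_smul, smul_eq_mul, hrdef]
      change a i * b j - b i * a j = _
      field_simp
      ring
    have hr0 : ∏ j ∈ S.erase i, (r i - r j) ≠ 0 := by
      refine Finset.prod_ne_zero_iff.2 fun j hj => sub_ne_zero.2 fun h => ?_
      exact (Finset.ne_of_mem_erase hj).symm (hr hi (Finset.mem_of_mem_erase hj) h)
    have hm : m (a i • v - b i • w) = a i * (m v - m w * r i) := by
      have h1 := ha i hi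
      simp only [map_sub, map_smul, smul_eq_mul, hrdef]
      field_simp
    rw [hprod, hm, mul_pow] at hIH
    have hai : a i ^ (S.card - 1) ≠ 0 := pow_ne_zero _ (ha i hi)
    have hsq : ((-1 : ℚ) ^ (S.card - 1)) * (-1) ^ (S.card - 1) = 1 := by
      rw [← mul_pow]; simp
    have hkey : c (S.erase i) * (∏ j ∈ S.erase i, a j) * (∏ j ∈ S.erase i, (r i - r j)) =
        (-1) ^ (S.card - 1) * (m v - m w * r i) ^ (S.card - 1) := by
      apply mul_left_cancel₀ hai
      linear_combination (-1 : ℚ) ^ (S.card - 1) * hIH - a i ^ (S.card - 1) *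
        (c (S.erase i) * (∏ j ∈ S.erase i, a j) * (∏ j ∈ S.erase i, (r i - r j))) * hsq
    rw [← Finset.mul_prod_erase S a hi]
    have hpi : p S i * a i = m w := hp S i hi w hwS hwL
    rw [mul_div_assoc', eq_div_iff hr0]
    linear_combination m w * hkey + c (S.erase i) * (∏ j ∈ S.erase i, a j) *
      (∏ j ∈ S.erase i, (r i - r j)) * hpi
  rw [hc S hS, Finset.sum_mul, Finset.sum_congr rfl hterm, ← Finset.mul_sum,
    sum_pow_div_prod_sub hS hr, mul_assoc, ← mul_pow]
  have := hS.card_pos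
  rw [neg_one_mul, neg_neg, ← pow_succ', Nat.sub_add_cancel this]

end Recursion

/-! ### Indices of subgroups, and finitely generated subgroups of `ℚ`. -/

section Lattices

/-- Insert `B + (ker f ∩ A)` between `B` and `A`: the upper index is seen in the image of `f`, the
lower one in the kernel. -/
theorem relIndex_eq_map_mul_inf_ker {G H : Type*} [AddCommGroup G] [AddCommGroup H]
    (f : G →+ H) {B A : AddSubgroup G} (hBA : B ≤ A) :
    B.relIndex A =
      (B.map f).relIndex (A.map f) * (B ⊓ f.ker).relIndex (A ⊓ f.ker) := by
  have h1 : (B.map f).relIndex (A.map f) = (B ⊔ f.ker ⊓ A).relIndex A := by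
    rw [AddSubgroup.relIndex_map_map, ← sup_inf_assoc_of_le _ hBA,
      AddSubgroup.inf_relIndex_right, ← AddSubgroup.relIndex_sup_right A (B ⊔ f.ker)]
    congr 1
    rw [← sup_assoc, sup_eq_left.2 hBA]
  have h2 : (B ⊓ f.ker).relIndex (A ⊓ f.ker) = B.relIndex (B ⊔ f.ker ⊓ A) := by
    rw [AddSubgroup.relIndex_sup_left, ← AddSubgroup.inf_relIndex_right B, inf_comm f.ker A,
      ← inf_assoc, inf_eq_left.2 hBA]
  rw [h1, h2, mul_comm, AddSubgroup.relIndex_mul_relIndex _ _ _ le_sup_left]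
  exact sup_le hBA inf_le_right

theorem relIndex_zmultiples_of_mem {a : ℚ} {k : ℤ} (ha : a ≠ 0) :
    (AddSubgroup.zmultiples (k • a)).relIndex (AddSubgroup.zmultiples a) = k.natAbs := by
  have h1 : AddSubgroup.zmultiples a = (⊤ : AddSubgroup ℤ).map (zmultiplesHom ℚ a) := by
    ext x
    simp [AddSubgroup.mem_zmultiples_iff]
  have h2 : AddSubgroup.zmultiples (k • a) =
      (AddSubgroup.zmultiples k).map (zmultiplesHom ℚ a) := by
    rw [AddMonoidHom.map_zmultiples]
    simp
  rw [h2, h1, AddSubgroup.relIndex_map_map_of_injective, AddSubgroup.relIndex_top_right,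
    Int.index_zmultiples]
  intro x y hxy
  simpa [ha] using hxy

/-- A nonzero finitely generated subgroup of `ℚ` is infinite cyclic. -/
theorem exists_zmultiples_of_closure {s : Set ℚ} (hs : s.Finite) {A : AddSubgroup ℚ}
    (hA : A ≤ AddSubgroup.closure s) (h1 : (1 : ℚ) ∈ A) :
    ∃ a : ℚ, 0 < a ∧ A = AddSubgroup.zmultiples a := by
  obtain ⟨d, hd⟩ := IsLocalization.exist_integer_multiples_of_finset (nonZeroDivisors ℤ)
    hs.toFinset
  have hd0 : ((d : ℤ) : ℚ) ≠ 0 := by exact_mod_cast nonZeroDivisors.coe_ne_zero d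
  have hint : ∀ x ∈ A, ∃ z : ℤ, (z : ℚ) = (d : ℤ) * x := by
    intro x hx
    replace hx := hA hx
    induction hx using AddSubgroup.closure_induction with
    | mem x hxs =>
      obtain ⟨z, hz⟩ := hd x (by simpa using hxs)
      exact ⟨z, by simpa using hz⟩
    | zero => exact ⟨0, by simp⟩
    | add x y _ _ hx hy =>
      obtain ⟨z, hz⟩ := hx
      obtain ⟨z', hz'⟩ := hy
      exact ⟨z + z', by push_cast; rw [hz, hz', mul_add]⟩
    | neg x _ hx =>
      obtain ⟨z, hz⟩ := hx
      exact ⟨-z, by push_cast; rw [hz, mul_neg]⟩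
  -- With a common denominator `d`, the subgroup `d A` lies in `ℤ`, and its generator `k` gives the
  -- generator `k / d` of `A`.
  obtain ⟨k, hk⟩ := Int.subgroup_cyclic
    ((A.map (AddMonoidHom.mulLeft ((d : ℤ) : ℚ))).comap (Int.castAddHom ℚ))
  have hmem : ∀ z : ℤ, z ∈ AddSubgroup.closure {k} ↔ ∃ x ∈ A, ((d : ℤ) : ℚ) * x = z := by
    intro z
    rw [← hk]
    simp
  have hmem' : ∀ x : ℚ, x ∈ A ↔ ∃ n : ℤ, n • ((k : ℚ) / (d : ℤ)) = x := by
    intro x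
    constructor
    · intro hx
      obtain ⟨z, hz⟩ := hint x hx
      obtain ⟨n, hn⟩ := AddSubgroup.mem_closure_singleton.1 ((hmem z).2 ⟨x, hx, hz.symm⟩)
      refine ⟨n, ?_⟩
      rw [← hn] at hz
      push_cast [zsmul_eq_mul, smul_eq_mul] at hz ⊢
      field_simp
      linarith
    · rintro ⟨n, rfl⟩
      obtain ⟨x, hx, hxk⟩ := (hmem k).1 (AddSubgroup.mem_closure_singleton.2 ⟨1, by simp⟩)
      refine A.zsmul_mem ?_ n
      rwa [← hxk, mul_div_cancel_left₀ _ hd0]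
  have hA' : A = AddSubgroup.zmultiples ((k : ℚ) / (d : ℤ)) := by
    ext x
    rw [hmem', AddSubgroup.mem_zmultiples_iff]
  obtain ⟨n, hn⟩ := (hmem' 1).1 h1
  rcases lt_trichotomy ((k : ℚ) / (d : ℤ)) 0 with h | h | h
  · exact ⟨-((k : ℚ) / (d : ℤ)), by linarith, by rw [AddSubgroup.zmultiples_neg, hA']⟩
  · simp [h] at hn
  · exact ⟨_, h, hA'⟩

end Lattices

/-! ### Multiplicities of the faces. -/

section Multiplicity

variable {V ι : Type*} [AddCommGroup V] [Module ℚ V]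

/-- The index of the lattice spanned by the basis vectors `e i`, `i ∈ S`, in the lattice of
points of `Λ` in their span. -/
def mult (Λ : AddSubgroup V) (e : Basis ι ℚ V) (S : Finset ι) : ℚ :=
  ((AddSubgroup.closure (Set.range e) ⊓ (coordSub e S).toAddSubgroup).relIndex
    (Λ ⊓ (coordSub e S).toAddSubgroup) : ℕ)

theorem mult_empty (Λ : AddSubgroup V) (e : Basis ι ℚ V) : mult Λ e ∅ = 1 := by
  have h : (coordSub e ∅).toAddSubgroup = ⊥ := by
    rw [coordSub_empty]
    rfl
  simp [mult, h]

variable [DecidableEq ι]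

theorem coordSub_erase_eq_inf_ker (e : Basis ι ℚ V) (S : Finset ι) (i : ι) :
    (coordSub e (S.erase i)).toAddSubgroup =
      (coordSub e S).toAddSubgroup ⊓ (e.coord i).toAddMonoidHom.ker := by
  ext x
  constructor
  · intro hx
    exact ⟨coordSub_mono (S.erase_subset i) hx, hx i (by simp)⟩
  · rintro ⟨hx, hi0⟩
    exact mem_coordSub_erase hx hi0

theorem map_coord_closure_inf (e : Basis ι ℚ V) {S : Finset ι} {i : ι} (hi : i ∈ S) :
    (AddSubgroup.closure (Set.range e) ⊓ (coordSub e S).toAddSubgroup).map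
      (e.coord i).toAddMonoidHom = AddSubgroup.zmultiples 1 := by
  apply le_antisymm
  · rintro _ ⟨x, ⟨hx, -⟩, rfl⟩
    have h : AddSubgroup.closure (Set.range e) ≤
        (AddSubgroup.zmultiples (1 : ℚ)).comap (e.coord i).toAddMonoidHom := by
      rw [AddSubgroup.closure_le]
      rintro _ ⟨j, rfl⟩
      change e.coord i (e j) ∈ AddSubgroup.zmultiples (1 : ℚ)
      rw [Basis.coord_apply, e.repr_self, Finsupp.single_apply]
      split_ifs
      · exact AddSubgroup.mem_zmultiples _
      · exact zero_mem _
    exact h hx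
  · rw [AddSubgroup.zmultiples_le]
    exact ⟨e i, ⟨AddSubgroup.subset_closure ⟨i, rfl⟩, basis_mem_coordSub e hi⟩, by simp⟩

/-- Apply the `i`-th coordinate to both lattices: the images are `ℤ` and `ℤ a`, of index `1 / a`,
and the kernels are the two lattices for `S.erase i`. -/
theorem mul_mult_eq_mult_erase {Λ : AddSubgroup V} {e : Basis ι ℚ V} (he : ∀ i, e i ∈ Λ)
    {S : Finset ι} {i : ι} (hi : i ∈ S) {a : ℚ} (ha : 0 < a)
    (hmap : (Λ ⊓ (coordSub e S).toAddSubgroup).map (e.coord i).toAddMonoidHom =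
      AddSubgroup.zmultiples a) :
    a * mult Λ e S = mult Λ e (S.erase i) := by
  have hle : AddSubgroup.closure (Set.range e) ⊓ (coordSub e S).toAddSubgroup ≤
      Λ ⊓ (coordSub e S).toAddSubgroup :=
    inf_le_inf_right _ ((AddSubgroup.closure_le _).2 (by rintro _ ⟨j, rfl⟩; exact he j))
  have h1 : (1 : ℚ) ∈ AddSubgroup.zmultiples a := by
    rw [← hmap]
    exact ⟨e i, ⟨he i, basis_mem_coordSub e hi⟩, by simp⟩
  obtain ⟨k, hk⟩ := AddSubgroup.mem_zmultiples_iff.1 h1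
  have hkpos : (0 : ℚ) < k := by
    rw [zsmul_eq_mul] at hk
    exact pos_of_mul_pos_left (by rw [hk]; exact one_pos) ha.le
  rw [mult, mult, relIndex_eq_map_mul_inf_ker (e.coord i).toAddMonoidHom hle, hmap,
    map_coord_closure_inf e hi, ← hk, relIndex_zmultiples_of_mem ha.ne', inf_assoc, inf_assoc,
    ← coordSub_erase_eq_inf_ker e S i]
  have hknat : ((k.natAbs : ℕ) : ℚ) = k := by
    rw [Nat.cast_natAbs, abs_of_pos (by exact_mod_cast hkpos)]
  rw [zsmul_eq_mul] at hk
  push_cast [hknat]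
  rw [← mul_assoc, mul_comm a, hk, one_mul]

theorem mult_univ [Fintype ι] {Λ : AddSubgroup V} {e v : Basis ι ℚ V} (he : ∀ i, e i ∈ Λ)
    (hv : Λ = AddSubgroup.closure (Set.range v)) : mult Λ e Finset.univ = |v.det e| := by
  have htop : (coordSub e Finset.univ).toAddSubgroup = ⊤ :=
    top_unique fun x _ j hj => (hj (Finset.mem_univ j)).elim
  rw [mult, htop, inf_top_eq, inf_top_eq]
  exact AddSubgroup.relIndex_eq_abs_det _ _
    ((AddSubgroup.closure_le _).2 (by rintro _ ⟨j, rfl⟩; exact he j)) e v rfl hv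

end Multiplicity

/-! ### Faces of a simplicial cone as subsets of a basis. -/

section FaceCone

variable {V ι : Type*} [AddCommGroup V] [Module ℚ V]

/-- The cone generated by the basis vectors with index in `S`. -/
def faceCone (e : Basis ι ℚ V) (S : Finset ι) : PointedCone ℚ V where
  carrier := {x | x ∈ coordSub e S ∧ ∀ i, 0 ≤ e.coord i x}
  zero_mem' := ⟨zero_mem _, fun _ => by rw [map_zero]⟩
  add_mem' := fun hx hy => ⟨add_mem hx.1 hy.1, fun i => by
    rw [map_add]; exact add_nonneg (hx.2 i) (hy.2 i)⟩
  smul_mem' := fun c x hx => ⟨(coordSub e S).smul_mem (c : ℚ) hx.1, fun i => by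
    change 0 ≤ e.coord i ((c : ℚ) • x)
    rw [map_smul]; exact mul_nonneg c.2 (hx.2 i)⟩

theorem mem_faceCone {e : Basis ι ℚ V} {S : Finset ι} {x : V} :
    x ∈ faceCone e S ↔ x ∈ coordSub e S ∧ ∀ i, 0 ≤ e.coord i x := Iff.rfl

theorem basis_mem_faceCone (e : Basis ι ℚ V) {S : Finset ι} {i : ι} :
    e i ∈ faceCone e S ↔ i ∈ S := by
  constructor
  · intro h
    by_contra hi
    have := h.1 i hi
    simp at this
  · refine fun hi => ⟨basis_mem_coordSub e hi, fun j => ?_⟩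
    classical
    rw [Basis.coord_apply, e.repr_self, Finsupp.single_apply]
    split_ifs <;> norm_num

theorem faceCone_injective (e : Basis ι ℚ V) : Function.Injective (faceCone e) := by
  intro S T h
  ext i
  rw [← basis_mem_faceCone e, h, basis_mem_faceCone]

theorem faceCone_mono (e : Basis ι ℚ V) : Monotone (faceCone e) :=
  fun _ _ h _ hx => ⟨coordSub_mono h hx.1, hx.2⟩

theorem faceCone_le_iff (e : Basis ι ℚ V) {S T : Finset ι} :
    faceCone e S ≤ faceCone e T ↔ S ⊆ T :=
  ⟨fun h _ hi => (basis_mem_faceCone e).1 (h ((basis_mem_faceCone e).2 hi)),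
    fun h => faceCone_mono e h⟩

theorem faceCone_empty (e : Basis ι ℚ V) : faceCone e ∅ = ⊥ := by
  refine (Submodule.eq_bot_iff _).2 fun x hx => ?_
  have := hx.1
  rwa [coordSub_empty, Submodule.mem_bot] at this

theorem faceCone_isFaceOf (e : Basis ι ℚ V) {S T : Finset ι} (h : S ⊆ T) :
    (faceCone e S).IsFaceOf (faceCone e T) := by
  refine ⟨faceCone_mono e h, fun {x y a} hx hy ha hxy => ⟨fun j hj => ?_, hx.2⟩⟩
  have h0 := hxy.1 j hj
  rw [map_add, map_smul, smul_eq_mul] at h0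
  have h1 := hx.2 j
  have h2 := hy.2 j
  have h3 := mul_nonneg ha.le h1
  have h4 : a * e.coord j x = 0 := by linarith
  exact (mul_eq_zero.1 h4).resolve_left ha.ne'

theorem faceCone_reindex {κ : Type*} (e : Basis ι ℚ V) (f : ι ≃ κ) (S : Finset ι) :
    faceCone (e.reindex f) (S.map f.toEmbedding) = faceCone e S := by
  ext x
  simp only [mem_faceCone, mem_coordSub, Basis.coord_apply, Basis.repr_reindex,
    Finsupp.mapDomain_equiv_apply, Finset.mem_map_equiv]
  exact and_congr (f.symm.forall_congr fun _ => Iff.rfl) (f.symm.forall_congr fun _ => Iff.rfl)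

theorem sum_coord_smul [Fintype ι] (e : Basis ι ℚ V) (x : V) :
    ∑ i, e.coord i x • e i = x := e.sum_repr x

/-- If a point of the face has positive `j`-th coordinate, subtracting that component leaves a point
of the cone, so the face property puts `e j` in the face. -/
theorem exists_eq_faceCone_of_isFaceOf [Fintype ι] {e : Basis ι ℚ V} {S : Finset ι}
    {F : PointedCone ℚ V} (hF : F.IsFaceOf (faceCone e S)) : ∃ T ⊆ S, F = faceCone e T := by
  classical
  refine ⟨S.filter fun i => e i ∈ F, Finset.filter_subset _ _, le_antisymm ?_ ?_⟩
  · intro x hx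
    have hxS := hF.le hx
    refine ⟨fun j hj => ?_, hxS.2⟩
    by_contra hne
    have hjS : j ∈ S := by
      by_contra h
      exact hne (hxS.1 j h)
    have hpos : 0 < e.coord j x := lt_of_le_of_ne (hxS.2 j) (Ne.symm hne)
    refine hj (Finset.mem_filter.2 ⟨hjS, ?_⟩)
    refine hF.mem_of_smul_add_mem (y := x - e.coord j x • e j)
      ((basis_mem_faceCone e).2 hjS) ⟨?_, fun k => ?_⟩ hpos (by rwa [add_sub_cancel])
    · exact sub_mem hxS.1 (Submodule.smul_mem _ _ (basis_mem_coordSub e hjS))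
    · rw [map_sub, map_smul, Basis.coord_apply e k (e j), e.repr_self, Finsupp.single_apply]
      split_ifs with h
      · subst h; simp
      · simpa using hxS.2 k
  · intro x hx
    rw [← sum_coord_smul e x]
    refine sum_mem fun i _ => ?_
    by_cases hi : i ∈ S.filter fun i => e i ∈ F
    · exact F.smul_mem (hx.2 i) (Finset.mem_filter.1 hi).2
    · rw [hx.1 i hi, zero_smul]
      exact zero_mem _

theorem faceCone_univ_eq_hull [Fintype ι] (e : Basis ι ℚ V) :
    faceCone e Finset.univ = PointedCone.hull ℚ (Set.range e) := by
  apply le_antisymm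
  · intro x hx
    rw [← sum_coord_smul e x]
    exact sum_mem fun i _ => Submodule.smul_mem (PointedCone.hull ℚ (Set.range e)) (⟨e.coord i x, hx.2 i⟩ : {c : ℚ // 0 ≤ c})
      (Submodule.subset_span ⟨i, rfl⟩)
  · rw [PointedCone.hull, Submodule.span_le]
    rintro _ ⟨i, rfl⟩
    exact (basis_mem_faceCone e).2 (Finset.mem_univ i)

end FaceCone

/-! ### Span, annihilator, dimension and facets of these cones. -/

section ConeInvariants

variable {N ι : Type*} [AddCommGroup N] {e : Basis ι ℚ (NQ N)}

theorem coord_mem_perp {S : Finset ι} {i : ι} (hi : i ∉ S) :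
    e.coord i ∈ perp (faceCone e S) :=
  mem_perp.2 fun _ hx => hx.1 i hi

variable [Fintype ι]

theorem linSpan_faceCone (S : Finset ι) : linSpan (faceCone e S) = coordSub e S := by
  apply le_antisymm
  · exact Submodule.span_le.2 fun x hx => hx.1
  · intro x hx
    rw [← sum_coord_smul e x]
    refine sum_mem fun i _ => ?_
    by_cases hi : i ∈ S
    · exact Submodule.smul_mem _ _ (Submodule.subset_span ((basis_mem_faceCone e).2 hi))
    · rw [hx i hi, zero_smul]
      exact zero_mem _

theorem apply_eq_zero_of_mem_perp {S : Finset ι} {u : MQ N} (hu : u ∈ perp (faceCone e S))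
    {x : NQ N} (hx : x ∈ coordSub e S) : u x = 0 := by
  rw [← linSpan_faceCone] at hx
  exact (Submodule.mem_dualAnnihilator u).1 hu x hx

theorem dim_faceCone (S : Finset ι) : dim (faceCone e S) = S.card := by
  classical
  have h : coordSub e S = Submodule.span ℚ (Set.range fun i : S => e i) := by
    apply le_antisymm
    · intro x hx
      rw [← sum_coord_smul e x]
      refine sum_mem fun i _ => ?_
      by_cases hi : i ∈ S
      · exact Submodule.smul_mem _ _ (Submodule.subset_span ⟨⟨i, hi⟩, rfl⟩)
      · rw [hx i hi, zero_smul]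
        exact zero_mem _
    · rw [Submodule.span_le]
      rintro _ ⟨i, rfl⟩
      exact basis_mem_coordSub e i.2
  rw [dim, linSpan_faceCone, h, finrank_span_eq_card (b := fun i : S => e i)
    (e.linearIndependent.comp _ Subtype.val_injective), Fintype.card_coe]

variable [DecidableEq ι]

theorem isFacet_faceCone_iff {γ : PointedCone ℚ (NQ N)} {S : Finset ι} :
    IsFacet γ (faceCone e S) ↔ ∃ i ∈ S, γ = faceCone e (S.erase i) := by
  constructor
  · rintro ⟨h1, h2, h3⟩
    obtain ⟨T, hT, rfl⟩ := exists_eq_faceCone_of_isFaceOf h1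
    obtain ⟨i, hiS, hiT⟩ : ∃ i ∈ S, i ∉ T := by
      by_contra! h
      exact h2 (congrArg _ (Finset.Subset.antisymm hT h))
    refine ⟨i, hiS, (h3 _ (faceCone_isFaceOf e (S.erase_subset i)) ?_ ?_).symm⟩
    · intro h
      have := faceCone_injective e h
      exact S.notMem_erase i (this.symm ▸ hiS : i ∈ S.erase i)
    · exact faceCone_mono e fun j hj => Finset.mem_erase.2 ⟨fun h => hiT (h ▸ hj), hT hj⟩
  · rintro ⟨i, hiS, rfl⟩
    refine ⟨faceCone_isFaceOf e (S.erase_subset i), ?_, fun γ h1 h2 h3 => ?_⟩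
    · intro h
      have := faceCone_injective e h
      exact S.notMem_erase i (this.symm ▸ hiS : i ∈ S.erase i)
    · obtain ⟨T, hT, rfl⟩ := exists_eq_faceCone_of_isFaceOf h1
      have hTne : T ≠ S := fun h => h2 (congrArg _ h)
      rw [faceCone_le_iff] at h3
      congr 1
      refine (Finset.Subset.antisymm h3 fun j hj => Finset.mem_erase.2 ⟨?_, hT hj⟩).symm
      rintro rfl
      refine hTne (Finset.Subset.antisymm hT fun k hk => ?_)
      rcases eq_or_ne k j with rfl | hne
      · exact hj
      · exact h3 (Finset.mem_erase.2 ⟨hne, hk⟩)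

end ConeInvariants

/-! ### Normal generators in coordinates. -/

section NormalGenerator

variable (N : Type*) [AddCommGroup N]

/-- The lattice `N`, as a subgroup of `ℚ ⊗ N`. -/
def lattice : AddSubgroup (NQ N) := (incl N).toAddMonoidHom.range

variable {N}

theorem incl_mem_lattice (x : N) : incl N x ∈ lattice N := ⟨x, rfl⟩

theorem mem_lattice {x : NQ N} : x ∈ lattice N ↔ ∃ y : N, incl N y = x := Iff.rfl

theorem lattice_eq_closure {κ : Type*} (b : Basis κ ℤ N) :
    lattice N = AddSubgroup.closure (Set.range (b.baseChange ℚ)) := by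
  have h : Set.range (b.baseChange ℚ) = (incl N).toAddMonoidHom '' Set.range b := by
    rw [← Set.range_comp]
    congr 1
    ext i
    exact b.baseChange_apply ℚ i
  have htop : AddSubgroup.closure (Set.range b) = ⊤ := by
    have := congrArg Submodule.toAddSubgroup b.span_eq
    rwa [Submodule.span_int_eq_addSubgroupClosure] at this
  rw [h, ← AddMonoidHom.map_closure, htop, lattice, AddMonoidHom.range_eq_map]

variable {ι : Type*} {e : Basis ι ℚ (NQ N)}

theorem exists_coord_generator [Module.Free ℤ N] [Module.Finite ℤ N]
    (he : ∀ i, e i ∈ lattice N) {S : Finset ι} {i : ι} (hi : i ∈ S) :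
    ∃ a : ℚ, 0 < a ∧ (lattice N ⊓ (coordSub e S).toAddSubgroup).map (e.coord i).toAddMonoidHom =
      AddSubgroup.zmultiples a := by
  refine exists_zmultiples_of_closure (s := (e.coord i).toAddMonoidHom ''
    Set.range ((Module.finBasis ℤ N).baseChange ℚ)) ((Set.finite_range _).image _) ?_
    ⟨e i, ⟨he i, basis_mem_coordSub e hi⟩, by simp⟩
  rw [← AddMonoidHom.map_closure, ← lattice_eq_closure]
  exact AddSubgroup.map_mono inf_le_left

/-- A large multiple of the sum of the lattice vectors `e j`, `j ∈ T`, outweighs every negative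
coordinate. This turns lattice points of a linear span into differences of lattice points of the
cone. -/
theorem exists_add_coord_nonneg (he : ∀ i, e i ∈ lattice N) (x : N) (T : Finset ι) :
    ∃ y : N, incl N y ∈ faceCone e T ∧ ∀ j ∈ T, 0 ≤ e.coord j (incl N (x + y)) := by
  classical
  choose n hn using fun i => mem_lattice.1 (he i)
  obtain ⟨K, hK⟩ : ∃ K : ℕ, ∀ j ∈ T, -e.coord j (incl N x) ≤ K := by
    obtain ⟨M, hM⟩ := (T.image fun j => -e.coord j (incl N x)).bddAbove
    obtain ⟨K, hK⟩ := exists_nat_ge M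
    exact ⟨K, fun j hj => (hM (Finset.mem_coe.2 (Finset.mem_image_of_mem _ hj))).trans hK⟩
  have hsum : incl N (K • ∑ j ∈ T, n j) = (K : ℚ) • ∑ j ∈ T, e j := by
    rw [map_nsmul, map_sum, Finset.sum_congr rfl fun j _ => hn j, Nat.cast_smul_eq_nsmul]
  have hcoord : ∀ j ∈ T, e.coord j (incl N (K • ∑ j ∈ T, n j)) = K := by
    intro j hj
    rw [hsum, map_smul, map_sum, Finset.sum_eq_single_of_mem j hj]
    · simp
    · intro k _ hkj
      rw [Basis.coord_apply, e.repr_self, Finsupp.single_eq_of_ne (Ne.symm hkj)]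
  refine ⟨K • ∑ j ∈ T, n j, ?_, fun j hj => ?_⟩
  · rw [hsum]
    exact (faceCone e T).smul_mem (Nat.cast_nonneg K)
      (sum_mem fun j hj => (basis_mem_faceCone e).2 hj)
  · rw [map_add, map_add, hcoord j hj]
    linarith [hK j hj]

theorem mem_latSpan_faceCone (he : ∀ i, e i ∈ lattice N) {x : N} {T : Finset ι}
    (hx : incl N x ∈ coordSub e T) : x ∈ latSpan (faceCone e T) := by
  obtain ⟨y, hy, hxy⟩ := exists_add_coord_nonneg he x T
  have hadd : incl N (x + y) ∈ coordSub e T := by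
    rw [map_add]
    exact add_mem hx hy.1
  rw [← add_sub_cancel_right x y]
  refine sub_mem (Submodule.subset_span ⟨hadd, fun j => ?_⟩) (Submodule.subset_span hy)
  by_cases hj : j ∈ T
  · exact hxy j hj
  · rw [hadd j hj]

variable [DecidableEq ι]

theorem exists_faceCone_point (he : ∀ i, e i ∈ lattice N) {S : Finset ι} {i : ι} {a : ℚ}
    (ha : 0 ≤ a)
    (hmem : a ∈ (lattice N ⊓ (coordSub e S).toAddSubgroup).map (e.coord i).toAddMonoidHom) :
    ∃ x : N, incl N x ∈ faceCone e S ∧ e.coord i (incl N x) = a := by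
  obtain ⟨_, ⟨⟨x, rfl⟩, hxS⟩, hxa⟩ := hmem
  change incl N x ∈ coordSub e S at hxS
  change e.coord i (incl N x) = a at hxa
  obtain ⟨y, hy, hxy⟩ := exists_add_coord_nonneg he x (S.erase i)
  have hadd : incl N (x + y) ∈ coordSub e S := by
    rw [map_add]
    exact add_mem hxS (coordSub_mono (S.erase_subset i) hy.1)
  have hcoord : e.coord i (incl N (x + y)) = a := by
    rw [map_add, map_add, hxa, hy.1 i (by simp), add_zero]
  refine ⟨x + y, ⟨hadd, fun j => ?_⟩, hcoord⟩
  rcases eq_or_ne j i with rfl | hne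
  · rwa [hcoord]
  by_cases hj : j ∈ S
  · exact hxy j (Finset.mem_erase.2 ⟨hne, hj⟩)
  · rw [hadd j hj]

/-- Modulo the lattice of the facet, a lattice point of the cone is determined by its `i`-th
coordinate, and on the cone these coordinates are natural multiples of `a`. -/
theorem isFirstPoint_mk (he : ∀ i, e i ∈ lattice N) {S : Finset ι} {i : ι} {a : ℚ}
    (ha : 0 < a)
    (hmap : (lattice N ⊓ (coordSub e S).toAddSubgroup).map (e.coord i).toAddMonoidHom =
      AddSubgroup.zmultiples a)
    {b : N} (hb : incl N b ∈ faceCone e S) (hba : e.coord i (incl N b) = a) :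
    IsFirstPoint (faceCone e (S.erase i)) (faceCone e S)
      (Submodule.Quotient.mk ⟨b, Submodule.subset_span hb⟩) := by
  ext q
  constructor
  · rintro ⟨x, hx, rfl⟩
    have hxa : e.coord i (incl N x) ∈ AddSubgroup.zmultiples a := by
      rw [← hmap]
      exact ⟨incl N x, ⟨incl_mem_lattice x, hx.1⟩, rfl⟩
    obtain ⟨l, hl⟩ := AddSubgroup.mem_zmultiples_iff.1 hxa
    have hl0 : 0 ≤ l := by
      have h := hx.2 i
      rw [← hl, zsmul_eq_mul] at h
      exact_mod_cast nonneg_of_mul_nonneg_left h ha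
    obtain ⟨k, rfl⟩ := Int.eq_ofNat_of_zero_le hl0
    refine ⟨k, ?_⟩
    change k • Submodule.Quotient.mk _ = _
    rw [← Submodule.Quotient.mk_smul, Submodule.Quotient.eq]
    refine mem_latSpan_faceCone he (x := k • b - x) ?_
    rw [map_sub, map_nsmul]
    refine mem_coordSub_erase (sub_mem (nsmul_mem hb.1 k) hx.1) ?_
    rw [map_sub, map_nsmul, hba, ← hl, natCast_zsmul, sub_self]
  · rintro ⟨k, rfl⟩
    refine ⟨k • b, ?_, rfl⟩
    rw [map_nsmul]
    exact nsmul_mem hb k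

variable [Fintype ι]

/-- `normalGen` is an arbitrary choice among first points, so its `i`-th coordinate must be shown to
be `a`. Once this is known, a representative differs from `a • e i` by a vector in the span of the
facet, which `u` kills. -/
theorem pairing_normalGen (he : ∀ i, e i ∈ lattice N) {S : Finset ι} {i : ι} (hi : i ∈ S) {a : ℚ}
    (ha : 0 < a)
    (hmap : (lattice N ⊓ (coordSub e S).toAddSubgroup).map (e.coord i).toAddMonoidHom =
      AddSubgroup.zmultiples a)
    (u : perp (faceCone e (S.erase i))) :
    pairing (faceCone e (S.erase i)) (faceCone e S) (Submodule.Quotient.mk u)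
      (normalGen (faceCone e (S.erase i)) (faceCone e S)) = a * (u : MQ N) (e i) := by
  obtain ⟨b, hb, hba⟩ := exists_faceCone_point he ha.le
    (hmap ▸ AddSubgroup.mem_zmultiples a)
  have hex : ∃ p, IsFirstPoint (faceCone e (S.erase i)) (faceCone e S) p :=
    ⟨_, isFirstPoint_mk he ha hmap hb hba⟩
  have hp : IsFirstPoint (faceCone e (S.erase i)) (faceCone e S)
      (normalGen (faceCone e (S.erase i)) (faceCone e S)) := by
    rw [normalGen, dif_pos hex]
    exact hex.choose_spec
  obtain ⟨x, hx, hxp⟩ : normalGen (faceCone e (S.erase i)) (faceCone e S) ∈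
      rayPoints (faceCone e (S.erase i)) (faceCone e S) := by
    rw [hp]
    exact ⟨1, one_smul _ _⟩
  obtain ⟨k, hk⟩ : (Submodule.Quotient.mk ⟨b, Submodule.subset_span hb⟩ :
      RelN (faceCone e (S.erase i)) (faceCone e S)) ∈
      Set.range fun k : ℕ => k • normalGen (faceCone e (S.erase i)) (faceCone e S) := by
    rw [← hp]
    exact ⟨b, hb, rfl⟩
  -- The coordinate is `l * a` with `l` an integer, while the explicit first point, of coordinate
  -- `a`, is a natural multiple `k` of the chosen one. So `k * l = 1` with `k ≥ 0`.
  have hxa : e.coord i (incl N x) = a := by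
    have h1 := congrArg (pairing (faceCone e (S.erase i)) (faceCone e S)
      (Submodule.Quotient.mk ⟨e.coord i, coord_mem_perp (by simp)⟩)) hk
    simp only [map_nsmul, hxp, pairing_mk] at h1
    rw [hba] at h1
    have hmem : e.coord i (incl N x) ∈ AddSubgroup.zmultiples a := by
      rw [← hmap]
      exact ⟨incl N x, ⟨incl_mem_lattice x, hx.1⟩, rfl⟩
    obtain ⟨l, hl⟩ := AddSubgroup.mem_zmultiples_iff.1 hmem
    rw [← hl, nsmul_eq_mul, zsmul_eq_mul, ← mul_assoc, mul_eq_right₀ ha.ne'] at h1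
    have h2 : (k : ℤ) * l = 1 := by exact_mod_cast h1
    have h3 : l = 1 := by
      rcases Int.eq_one_or_neg_one_of_mul_eq_one' h2 with h | h <;> omega
    rw [← hl, h3, one_smul]
  rw [hxp, pairing_mk, ← hxa]
  have hsub : (u : MQ N) (incl N x - e.coord i (incl N x) • e i) = 0 := by
    refine apply_eq_zero_of_mem_perp u.2 (mem_coordSub_erase
      (sub_mem hx.1 (Submodule.smul_mem _ _ (basis_mem_coordSub e hi))) ?_)
    simp
  rwa [map_sub, map_smul, smul_eq_mul, sub_eq_zero] at hsub

end NormalGenerator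

/-! ### The divisor action restricted to faces of the cone. -/

section Action

variable {N : Type*} [AddCommGroup N] {Δ : Fan N}

theorem Complements.act_apply (C : Complements Δ) (D : QCartier Δ) (z : Cycles Δ) (τ : Δ.Cone) :
    C.act D z τ = ∑ ρ : Δ.Cone, z ρ * C.actOn D ρ τ := by
  rw [act, Finsupp.linearCombination_apply, Finsupp.sum_fintype _ _ (by simp),
    Finsupp.finsetSum_apply]
  rfl

theorem Complements.actOn_apply_of_isFacet (C : Complements Δ) (D : QCartier Δ) {ρ τ : Δ.Cone}
    (h : IsFacet ρ.1 τ.1) :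
    C.actOn D ρ τ =
      pairing ρ.1 τ.1 (C.proj ρ τ h.1.le (D.localEq τ)) (normalGen ρ.1 τ.1) := by
  classical
  rw [actOn, Finsupp.finsetSum_apply, Finset.sum_eq_single_of_mem τ (Finset.mem_univ _),
    dif_pos h]
  · simp [orbitCycle]
  · intro b _ hb
    split_ifs
    · simp [orbitCycle, Finsupp.single_eq_of_ne hb.symm]
    · rfl

theorem Complements.actOn_apply_of_not_isFacet (C : Complements Δ) (D : QCartier Δ) {ρ τ : Δ.Cone}
    (h : ¬ IsFacet ρ.1 τ.1) : C.actOn D ρ τ = 0 := by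
  classical
  rw [actOn, Finsupp.finsetSum_apply]
  refine Finset.sum_eq_zero fun b _ => ?_
  split_ifs with hb
  · rcases eq_or_ne b τ with rfl | hne
    · exact (h hb).elim
    · simp [orbitCycle, Finsupp.single_eq_of_ne hne.symm]
  · rfl

theorem Complements.power_zero_faceCone_empty {ι : Type*} {e : Basis ι ℚ (NQ N)}
    (C : Complements Δ) (D : QCartier Δ) (h : faceCone e ∅ ∈ Δ.cones) :
    C.power D 0 ⟨faceCone e ∅, h⟩ = 1 := by
  have h' : (⟨faceCone e ∅, h⟩ : Δ.Cone) = ⟨⊥, Δ.bot_mem⟩ := Subtype.ext (faceCone_empty e)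
  rw [h', Complements.power, pow_zero, Module.End.one_apply, fundamentalCycle, orbitCycle,
    Finsupp.single_eq_same]

variable {ι : Type*} [Fintype ι] [DecidableEq ι] {e : Basis ι ℚ (NQ N)}

theorem Complements.act_apply_faceCone (C : Complements Δ) (D : QCartier Δ)
    (hΔ : ∀ S, faceCone e S ∈ Δ.cones) (z : Cycles Δ) (S : Finset ι) :
    C.act D z ⟨faceCone e S, hΔ S⟩ =
      ∑ i ∈ S, z ⟨faceCone e (S.erase i), hΔ _⟩ *
        C.actOn D ⟨faceCone e (S.erase i), hΔ _⟩ ⟨faceCone e S, hΔ S⟩ := by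
  classical
  have hinj : Set.InjOn (fun i => (⟨faceCone e (S.erase i), hΔ _⟩ : Δ.Cone)) S := by
    intro i hi j hj hij
    have h := faceCone_injective e (Subtype.ext_iff.1 hij)
    by_contra hne
    have : i ∈ S.erase j := Finset.mem_erase.2 ⟨hne, hi⟩
    rw [← h] at this
    simp at this
  rw [act_apply, ← Finset.sum_image
    (f := fun ρ : Δ.Cone => z ρ * C.actOn D ρ ⟨faceCone e S, hΔ S⟩) hinj]
  symm
  refine Finset.sum_subset (Finset.subset_univ _) fun ρ _ hρ => ?_
  rw [C.actOn_apply_of_not_isFacet, mul_zero]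
  intro h
  obtain ⟨i, hi, h'⟩ := isFacet_faceCone_iff.1 h
  exact hρ (Finset.mem_image.2 ⟨i, hi, Subtype.ext h'.symm⟩)

/-- The value `⟨π_σ(m), e i⟩` for `σ` the facet opposite to `e i` of the cone spanned by the
`e j`, `j ∈ S`. -/
def Complements.edgeValue (C : Complements Δ) (hΔ : ∀ S, faceCone e S ∈ Δ.cones)
    (m : MQ N) (S : Finset ι) (i : ι) : ℚ :=
  ((perp (faceCone e (S.erase i))).projectionOnto _
    (C.isCompl ⟨faceCone e (S.erase i), hΔ _⟩) m : MQ N) (e i)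

theorem Complements.actOn_faceCone (C : Complements Δ) (D : QCartier Δ)
    (hΔ : ∀ S, faceCone e S ∈ Δ.cones) (he : ∀ i, e i ∈ lattice N) {m : MQ N} {S : Finset ι}
    (hm : D.localEq ⟨faceCone e S, hΔ S⟩ = Submodule.Quotient.mk m) {i : ι} (hi : i ∈ S)
    {a : ℚ} (ha : 0 < a)
    (hmap : (lattice N ⊓ (coordSub e S).toAddSubgroup).map (e.coord i).toAddMonoidHom =
      AddSubgroup.zmultiples a) :
    C.actOn D ⟨faceCone e (S.erase i), hΔ _⟩ ⟨faceCone e S, hΔ S⟩ =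
      a * C.edgeValue hΔ m S i := by
  rw [C.actOn_apply_of_isFacet D (isFacet_faceCone_iff.2 ⟨i, hi, rfl⟩), hm]
  exact pairing_normalGen he hi ha hmap _

variable [Module.Free ℤ N] [Module.Finite ℤ N]

/-- Each coefficient of the action carries a lattice factor `a`, and `a` times the multiplicity of
`S` is that of `S.erase i`. Weighting by multiplicities thus removes the lattice from the recursion.
-/
theorem Complements.power_mul_mult (C : Complements Δ) (D : QCartier Δ)
    (hΔ : ∀ S, faceCone e S ∈ Δ.cones) (he : ∀ i, e i ∈ lattice N) {m : MQ N}
    (hm : ∀ S, D.localEq ⟨faceCone e S, hΔ S⟩ = Submodule.Quotient.mk m) {S : Finset ι}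
    (hS : S.Nonempty) :
    C.power D S.card ⟨faceCone e S, hΔ S⟩ * mult (lattice N) e S =
      ∑ i ∈ S, C.power D (S.erase i).card ⟨faceCone e (S.erase i), hΔ _⟩ *
        mult (lattice N) e (S.erase i) * C.edgeValue hΔ m S i := by
  obtain ⟨k, hk⟩ := Nat.exists_eq_succ_of_ne_zero hS.card_ne_zero
  have h : C.power D S.card = C.act D (C.power D k) := by
    rw [power, power, hk, Nat.succ_eq_add_one, pow_succ', Module.End.mul_apply]
  rw [h, C.act_apply_faceCone, Finset.sum_mul]
  refine Finset.sum_congr rfl fun i hi => ?_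
  obtain ⟨a, ha, hmap⟩ := exists_coord_generator he hi
  rw [C.actOn_faceCone D hΔ he (hm S) hi ha hmap, ← mul_mult_eq_mult_erase he hi ha hmap,
    Finset.card_erase_of_mem hi, hk, Nat.succ_sub_one]
  ring

end Action

/-! ### Generic flags as transverse filtrations. -/

section FlagFiltration

variable {N : Type*} [AddCommGroup N]

/-- A complete flag as a filtration indexed by `ℕ`, constant from the rank on. -/
def CompleteFlag.filtration (F : CompleteFlag N) (k : ℕ) : Submodule ℚ (MQ N) :=
  F.L ⟨min k (finrank ℤ N), Nat.lt_succ_of_le (min_le_right _ _)⟩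

theorem CompleteFlag.filtration_mono (F : CompleteFlag N) : Monotone F.filtration :=
  fun _ _ h => F.strictMono.monotone (by
    rw [Fin.mk_le_mk]
    exact min_le_min_right _ h)

theorem CompleteFlag.filtration_of_le (F : CompleteFlag N) {k : ℕ} (hk : k ≤ finrank ℤ N) :
    F.filtration k = F.L ⟨k, Nat.lt_succ_of_le hk⟩ := by
  simp only [filtration, min_eq_left hk]

variable [Module.Free ℤ N] [Module.Finite ℤ N] {Δ : Fan N} {F : CompleteFlag N}
  {hF : F.IsGeneric Δ}
variable {ι : Type*} [Fintype ι] {e : Basis ι ℚ (NQ N)}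

theorem CompleteFlag.complements_faceCone {S : Finset ι} (h : faceCone e S ∈ Δ.cones) :
    (F.complements hF).Ψ ⟨faceCone e S, h⟩ = F.filtration S.card := by
  have hc := dim_faceCone (e := e) S
  rw [← hc, F.filtration_of_le (dim_le _)]
  rfl

/-- Every functional is a sum of one annihilating the face and one in the flag, and both parts
vanish on such an `x`. -/
theorem CompleteFlag.isTransverse (hF : F.IsGeneric Δ) (hΔ : ∀ S, faceCone e S ∈ Δ.cones) :
    IsTransverse e F.filtration := by
  intro S x hx hxL
  rw [← Module.forall_dual_apply_eq_zero_iff ℚ x]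
  intro u
  have hC := (F.complements hF).isCompl ⟨faceCone e S, hΔ S⟩
  rw [CompleteFlag.complements_faceCone] at hC
  obtain ⟨u₁, h₁, u₂, h₂, rfl⟩ := Submodule.mem_sup.1
    (hC.sup_eq_top ▸ Submodule.mem_top : u ∈ perp (faceCone e S) ⊔ F.filtration S.card)
  rw [LinearMap.add_apply, hxL u₂ h₂, apply_eq_zero_of_mem_perp h₁ hx, add_zero]

variable [DecidableEq ι]

/-- The difference of `m` and its projection lies in `L_{|S|-1}`, so both agree on `w`. The
projection annihilates the facet, so on `w` it sees only the component along `e i`. -/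
theorem CompleteFlag.edgeValue_mul_coord (hΔ : ∀ S, faceCone e S ∈ Δ.cones) (m : MQ N)
    {S : Finset ι} {i : ι} (hi : i ∈ S) {w : NQ N} (hw : w ∈ coordSub e S)
    (hwL : ∀ u ∈ F.filtration (S.card - 1), u w = 0) :
    (F.complements hF).edgeValue hΔ m S i * e.coord i w = m w := by
  set P := (perp (faceCone e (S.erase i))).projectionOnto _
    ((F.complements hF).isCompl ⟨faceCone e (S.erase i), hΔ _⟩) with hP
  have h1 : m - (P m : MQ N) ∈ F.filtration (S.card - 1) := by
    rw [← Finset.card_erase_of_mem hi, ← CompleteFlag.complements_faceCone (hF := hF) (hΔ _),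
      ← Submodule.projectionOnto_apply_eq_zero_iff
        ((F.complements hF).isCompl ⟨faceCone e (S.erase i), hΔ _⟩), map_sub, ← hP, sub_eq_zero]
    exact (Submodule.projectionOnto_apply_left _ (P m)).symm
  have h2 := hwL _ h1
  have h3 : (P m : MQ N) (w - e.coord i w • e i) = 0 := by
    refine apply_eq_zero_of_mem_perp (P m).2 (mem_coordSub_erase
      (sub_mem hw (Submodule.smul_mem _ _ (basis_mem_coordSub e hi))) ?_)
    simp
  rw [map_sub, map_smul, smul_eq_mul, sub_eq_zero] at h3
  rw [LinearMap.sub_apply, sub_eq_zero] at h2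
  rw [h2, h3, mul_comm]
  rfl

/-- For `i ∈ S`, the functional `u ↦ (P u) (e i)` on the dual space, with `P` the projection for the
facet opposite to `e i`, is evaluation at a vector `v`. It vanishes on the flag space because `P`
does, and `v_i = 1` because `P` fixes the `i`-th coordinate function. -/
theorem CompleteFlag.exists_normal_vector (hF : F.IsGeneric Δ)
    (hΔ : ∀ S, faceCone e S ∈ Δ.cones) (S : Finset ι) :
    ∃ v ∈ coordSub e S, (∀ u ∈ F.filtration (S.card - 1), u v = 0) ∧
      ∀ i ∈ S, e.coord i v ≠ 0 := by
  rcases S.eq_empty_or_nonempty with rfl | ⟨i, hi⟩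
  · exact ⟨0, zero_mem _, by simp, by simp⟩
  set P := (perp (faceCone e (S.erase i))).projectionOnto _
    ((F.complements hF).isCompl ⟨faceCone e (S.erase i), hΔ _⟩) with hP
  have hPfix : ∀ u ∈ perp (faceCone e (S.erase i)), (P u : MQ N) = u := fun u hu => by
    rw [hP, Submodule.projectionOnto_apply_left _ ⟨u, hu⟩]
  set v : NQ N := ∑ j, (P (e.coord j) : MQ N) (e i) • e j with hv
  have hcoord : ∀ j, e.coord j v = (P (e.coord j) : MQ N) (e i) := by
    intro j
    rw [Basis.coord_apply, hv, e.repr_sum_self]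
  have happly : ∀ u : MQ N, u v = (P u : MQ N) (e i) := by
    intro u
    have h : (P u : MQ N) (e i) = ∑ j, u (e j) * (P (e.coord j) : MQ N) (e i) := by
      conv_lhs => rw [← e.sum_dual_apply_smul_coord u]
      simp only [map_sum, map_smul, Submodule.coe_sum, Submodule.coe_smul, LinearMap.sum_apply,
        LinearMap.smul_apply, smul_eq_mul]
    rw [h, hv, map_sum]
    exact Finset.sum_congr rfl fun j _ => by rw [map_smul, smul_eq_mul, mul_comm]
  have hvS : v ∈ coordSub e S := by
    intro j hj
    rw [hcoord, hPfix _ (coord_mem_perp fun h => hj (Finset.mem_of_mem_erase h)),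
      Basis.coord_apply, e.repr_self, Finsupp.single_eq_of_ne]
    rintro rfl
    exact hj hi
  have hvL : ∀ u ∈ F.filtration (S.card - 1), u v = 0 := by
    intro u hu
    rw [← Finset.card_erase_of_mem hi,
      ← CompleteFlag.complements_faceCone (hF := hF) (hΔ _)] at hu
    rw [happly, hP, Submodule.projectionOnto_apply_right _ ⟨u, hu⟩]
    rfl
  have hv0 : v ≠ 0 := by
    intro h0
    have h1 := hcoord i
    rw [h0, hPfix _ (coord_mem_perp (by simp))] at h1
    simp at h1
  exact ⟨v, hvS, hvL, (CompleteFlag.isTransverse hF hΔ).coord_ne_zero hv0 hvS hvL⟩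

theorem CompleteFlag.power_mul_mult_mul_prod (D : QCartier Δ)
    (hΔ : ∀ S, faceCone e S ∈ Δ.cones) (he : ∀ i, e i ∈ lattice N) {m : MQ N}
    (hm : ∀ S, D.localEq ⟨faceCone e S, hΔ S⟩ = Submodule.Quotient.mk m) {S : Finset ι}
    {w : NQ N} (hw : w ∈ coordSub e S) (hwL : ∀ u ∈ F.filtration (S.card - 1), u w = 0)
    (hw0 : ∀ i ∈ S, e.coord i w ≠ 0) :
    (F.complements hF).power D S.card ⟨faceCone e S, hΔ S⟩ * mult (lattice N) e S *
      ∏ i ∈ S, e.coord i w = m w ^ S.card := by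
  refine (CompleteFlag.isTransverse hF hΔ).chain_sum_eq F.filtration_mono
    (CompleteFlag.exists_normal_vector hF hΔ)
    (c := fun S => (F.complements hF).power D S.card ⟨faceCone e S, hΔ S⟩ * mult (lattice N) e S)
    (p := (F.complements hF).edgeValue hΔ m) ?_ ?_ ?_ S w hw hwL hw0
  · change (F.complements hF).power D 0 ⟨faceCone e ∅, hΔ ∅⟩ * mult (lattice N) e ∅ = 1
    rw [Complements.power_zero_faceCone_empty, mult_empty, mul_one]
  · exact fun S hS => (F.complements hF).power_mul_mult D hΔ he hm hS
  · exact fun S i hi w hw hwL => CompleteFlag.edgeValue_mul_coord hΔ m hi hw hwL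

end FlagFiltration

/-! ### Lattice bases of simplicial cones and the volume condition. -/

section SimplicialCone

variable {N : Type*} [AddCommGroup N]

theorem exists_pos_smul_mem_lattice (x : NQ N) :
    ∃ d : ℚ, 0 < d ∧ d • x ∈ lattice N := by
  have : IsLocalizedModule (nonZeroDivisors ℤ) (incl N) :=
    (isLocalizedModule_iff_isBaseChange (nonZeroDivisors ℤ) ℚ (incl N)).2
      (TensorProduct.isBaseChange ℤ N ℚ)
  obtain ⟨⟨y, s⟩, hs⟩ := IsLocalizedModule.surj (nonZeroDivisors ℤ) (incl N) x
  have hs0 : ((s : ℤ) : ℚ) ≠ 0 := by exact_mod_cast nonZeroDivisors.coe_ne_zero s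
  have hsx : ((s : ℤ) : ℚ) • x = incl N y := by
    rw [Int.cast_smul_eq_zsmul]
    exact hs
  rcases lt_or_gt_of_ne hs0 with h | h
  · exact ⟨-(s : ℤ), by linarith, -y, by
      rw [neg_smul, hsx]
      exact map_neg (incl N) y⟩
  · exact ⟨_, h, y, hsx.symm⟩

theorem eq_smul_coord_of_mem_perp {ι : Type*} [Fintype ι] [DecidableEq ι]
    {e : Basis ι ℚ (NQ N)} {i : ι} {t : MQ N} (ht : t ∈ perp (faceCone e (Finset.univ.erase i))) :
    t = t (e i) • e.coord i := by
  refine e.ext fun j => ?_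
  rw [LinearMap.smul_apply, Basis.coord_apply, e.repr_self, smul_eq_mul]
  rcases eq_or_ne j i with rfl | hne
  · simp
  · rw [Finsupp.single_eq_of_ne hne.symm, mul_zero]
    exact mem_perp.1 ht _ ((basis_mem_faceCone e).2 (Finset.mem_erase.2 ⟨hne, Finset.mem_univ j⟩))

variable [Module.Free ℤ N] [Module.Finite ℤ N]

/-- A full-dimensional simplicial cone is spanned by a basis consisting of lattice points. -/
theorem exists_basis_of_isSimplicial {σ : PointedCone ℚ (NQ N)} (hσ : σ.IsSimplicial)
    (hdim : dim σ = finrank ℤ N) :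
    ∃ e : Basis (Fin (finrank ℤ N)) ℚ (NQ N),
      (∀ i, e i ∈ lattice N) ∧ faceCone e Finset.univ = σ := by
  obtain ⟨s, hs, hli, rfl⟩ := hσ
  have hspan : linSpan (PointedCone.hull ℚ s) = Submodule.span ℚ s :=
    Submodule.span_span_of_tower _ _ _
  have htop : Submodule.span ℚ s = ⊤ := by
    apply Submodule.eq_top_of_finrank_eq
    rw [← hspan, Module.finrank_baseChange]
    exact hdim
  let b : Basis s ℚ (NQ N) := Basis.mk (v := fun x : s => (x : NQ N)) hli (by simp [htop])
  have : Fintype s := hs.fintype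
  have hcard : Fintype.card s = finrank ℤ N := by
    rw [← Module.finrank_eq_card_basis b, Module.finrank_baseChange]
  choose d hd hdl using fun x : NQ N => exists_pos_smul_mem_lattice x
  -- Positive rescaling moves the generators into the lattice without changing the cone.
  let c : Basis s ℚ (NQ N) := b.isUnitSMul (w := fun x => d x) fun x => (hd x).ne'.isUnit
  have hc : ∀ x : s, c x = d x • (x : NQ N) := fun x => by
    rw [Basis.isUnitSMul_apply, show b x = x from Basis.mk_apply hli _ x]
  refine ⟨c.reindex (Fintype.equivFinOfCardEq hcard), fun i => ?_, ?_⟩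
  · rw [Basis.reindex_apply, hc]
    exact hdl _
  · rw [faceCone_univ_eq_hull, Basis.range_reindex]
    apply le_antisymm
    · rw [PointedCone.hull, Submodule.span_le]
      rintro _ ⟨x, rfl⟩
      rw [hc]
      exact PointedCone.smul_mem _ (hd x).le (Submodule.subset_span x.2)
    · rw [PointedCone.hull, Submodule.span_le]
      intro x hx
      have h : x = (d x)⁻¹ • c ⟨x, hx⟩ := by
        rw [hc, inv_smul_smul₀ (hd x).ne']
      rw [h]
      exact PointedCone.smul_mem _ (inv_nonneg.2 (hd x).le) (Submodule.subset_span ⟨_, rfl⟩)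

/-- If the facets of a full-dimensional simplicial cone are enumerated as `τ i`, then the cone is
spanned by a basis of lattice points for which `τ i` is the facet opposite to the `i`-th vector. -/
theorem exists_basis_opposite_facets {σ : PointedCone ℚ (NQ N)} (hσ : σ.IsSimplicial)
    (hdim : dim σ = finrank ℤ N) {τ : Fin (finrank ℤ N) → PointedCone ℚ (NQ N)}
    (hτ : Function.Injective τ) (hfacet : ∀ i, IsFacet (τ i) σ) :
    ∃ e : Basis (Fin (finrank ℤ N)) ℚ (NQ N), (∀ i, e i ∈ lattice N) ∧
      faceCone e Finset.univ = σ ∧ ∀ i, τ i = faceCone e (Finset.univ.erase i) := by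
  obtain ⟨e, he, rfl⟩ := exists_basis_of_isSimplicial hσ hdim
  choose p _ hp using fun i => isFacet_faceCone_iff.1 (hfacet i)
  -- Distinct facets are opposite to distinct basis vectors; as there are as many facets `τ i` as
  -- vectors, `p` is a permutation by which to reindex.
  have hpinj : Function.Injective p := fun i j hij => hτ (by rw [hp, hp, hij])
  let f : Fin (finrank ℤ N) ≃ Fin (finrank ℤ N) :=
    Equiv.ofBijective p (Finite.injective_iff_bijective.1 hpinj)
  have hcone : ∀ S, faceCone (e.reindex f.symm) S = faceCone e (S.map f.toEmbedding) := by
    intro S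
    rw [← faceCone_reindex e f.symm, Finset.map_map]
    congr 1
    ext i
    simp
  refine ⟨e.reindex f.symm, fun i => ?_, ?_, fun i => ?_⟩
  · rw [Basis.reindex_apply]
    exact he _
  · rw [hcone, Finset.map_univ_equiv]
  · rw [hcone, Finset.map_erase, Finset.map_univ_equiv, hp]
    rfl

/-- The matrix in the volume is the transpose of a diagonal matrix times the change of basis from
the lattice basis to `e`. The multiplicity is the absolute determinant of the inverse change of
basis, so only the diagonal remains. -/
theorem latticeVolume_eq {e : Basis (Fin (finrank ℤ N)) ℚ (NQ N)}
    (he : ∀ i, e i ∈ lattice N) {t : Fin (finrank ℤ N) → MQ N} {s : Fin (finrank ℤ N) → ℚ}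
    (ht : ∀ i, t i = s i • e.coord i) :
    latticeVolume (Fin.cons 0 t) * mult (lattice N) e Finset.univ =
      |∏ i, s i| / ((finrank ℤ N).factorial : ℚ) := by
  set v := (Module.finBasis ℤ N).baseChange ℚ with hv
  have hdet : (Matrix.of fun i j : Fin (finrank ℤ N) =>
      ((Fin.cons 0 t : Fin (finrank ℤ N + 1) → MQ N) j.succ -
        (Fin.cons 0 t : Fin (finrank ℤ N + 1) → MQ N) 0)
          (incl N (Module.finBasis ℤ N i))).det = (∏ i, s i) * e.det v := by
    have hmat : (Matrix.of fun i j : Fin (finrank ℤ N) =>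
        ((Fin.cons 0 t : Fin (finrank ℤ N + 1) → MQ N) j.succ -
          (Fin.cons 0 t : Fin (finrank ℤ N + 1) → MQ N) 0)
            (incl N (Module.finBasis ℤ N i))) =
        (Matrix.diagonal s * e.toMatrix v).transpose := by
      ext i j
      rw [Matrix.transpose_apply, Matrix.diagonal_mul, Matrix.of_apply, Fin.cons_succ,
        Fin.cons_zero, sub_zero, ht, hv, Basis.toMatrix_apply, Basis.baseChange_apply]
      rfl
    rw [hmat, Matrix.det_transpose, Matrix.det_mul, Matrix.det_diagonal, Basis.det_apply]
  rw [latticeVolume, hdet, mult_univ he (lattice_eq_closure _), ← hv, div_mul_eq_mul_div,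
    ← abs_mul, mul_assoc, Basis.det_apply, Basis.det_apply, ← Matrix.det_mul,
    Basis.toMatrix_mul_toMatrix_flip, Matrix.det_one, mul_one]

end SimplicialCone

end ToricCycle

end

/-! ### The coefficient formula. -/

theorem theorem15p1 {N : Type*} [AddCommGroup N] [Module.Free ℤ N] [Module.Finite ℤ N]
    (Δ : ToricCycle.Fan N)
    (F : ToricCycle.CompleteFlag N) (hF : F.IsGeneric Δ)
    (D : ToricCycle.QCartier Δ)
    (σ : Δ.Cone) (hσ : σ.1.IsSimplicial) (hdim : ToricCycle.dim σ.1 = Module.finrank ℤ N)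
    (m : ToricCycle.MQ N) (hm : D.localEq σ = Submodule.Quotient.mk m)
    (τ : Fin (Module.finrank ℤ N) → Δ.Cone) (hτ : Function.Injective τ)
    (hfacet : ∀ γ : Δ.Cone, γ ∈ Set.range τ ↔ ToricCycle.IsFacet γ.1 σ.1)
    (w : ToricCycle.NQ N) (hw : w ≠ 0)
    (hwL : ∀ u ∈ F.L ⟨Module.finrank ℤ N - 1, Nat.lt_succ_of_le (Nat.sub_le _ _)⟩, u w = 0)
    (t : Fin (Module.finrank ℤ N) → ToricCycle.MQ N)
    (ht : ∀ i, t i ∈ ToricCycle.starCone (τ i).1 σ.1)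
    (hvol : ToricCycle.latticeVolume (Fin.cons 0 t) =
      1 / ((Module.finrank ℤ N).factorial : ℚ)) :
    (∀ i, t i w ≠ 0) ∧
      (F.complements hF).power D (Module.finrank ℤ N) σ =
        m w ^ Module.finrank ℤ N / ∏ i, t i w := by
  open ToricCycle in
  obtain ⟨e, he, heσ, heτ⟩ := exists_basis_opposite_facets hσ hdim
    (Subtype.val_injective.comp hτ) fun i => (hfacet (τ i)).1 ⟨i, rfl⟩
  obtain ⟨σ, hσΔ⟩ := σ
  dsimp only at heσ
  subst heσ
  have hΔ : ∀ S, faceCone e S ∈ Δ.cones := fun S =>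
    Δ.face_mem _ hσΔ _ (faceCone_isFaceOf e (Finset.subset_univ S))
  -- By compatibility on faces, one representative `m` serves as local equation on every face, as
  -- the recursion requires.
  have hloc : ∀ S, D.localEq ⟨faceCone e S, hΔ S⟩ = Submodule.Quotient.mk m := fun S => by
    rw [← D.compat ⟨faceCone e S, hΔ S⟩ ⟨faceCone e Finset.univ, hσΔ⟩
      (faceCone_isFaceOf e (Finset.subset_univ S)), hm]
    rfl
  have hcard : (Finset.univ : Finset (Fin (Module.finrank ℤ N))).card = Module.finrank ℤ N :=
    Finset.card_fin _
  have hwL' : ∀ u ∈ F.filtration ((Finset.univ : Finset (Fin (Module.finrank ℤ N))).card - 1),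
      u w = 0 := by
    rw [hcard, F.filtration_of_le (Nat.sub_le _ _)]
    exact hwL
  have hwU : w ∈ coordSub e Finset.univ := fun j hj => (hj (Finset.mem_univ j)).elim
  have hw0 := (CompleteFlag.isTransverse hF hΔ).coord_ne_zero hw hwU hwL'
  have hmain := CompleteFlag.power_mul_mult_mul_prod (hF := hF) D hΔ he hloc hwU hwL' hw0
  rw [hcard] at hmain
  have hts : ∀ i, t i = t i (e i) • e.coord i := fun i =>
    eq_smul_coord_of_mem_perp (by rw [← heτ i]; exact (ht i).1)
  have hs0 : ∀ i, 0 ≤ t i (e i) := fun i =>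
    (ht i).2 _ ((basis_mem_faceCone e).2 (Finset.mem_univ i))
  -- The volume is `1 / n!`, and nonnegativity of the `t_i` on the cone removes the absolute value.
  have hmult : mult (lattice N) e Finset.univ = ∏ i, t i (e i) := by
    have h := latticeVolume_eq he hts
    have hfac : ((Module.finrank ℤ N).factorial : ℚ) ≠ 0 := by
      exact_mod_cast Nat.factorial_ne_zero _
    rw [hvol, abs_of_nonneg (Finset.prod_nonneg fun i _ => hs0 i), div_mul_eq_mul_div, one_mul,
      div_left_inj' hfac] at h
    exact h
  -- The product is the multiplicity, the absolute determinant of one basis in another, so no `t_i`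
  -- vanishes on its `e i`.
  have hprod0 : ∏ i, t i (e i) ≠ 0 := by
    rw [← hmult, mult_univ he (lattice_eq_closure (Module.finBasis ℤ N))]
    exact abs_ne_zero.2 (Module.Basis.isUnit_det _ _).ne_zero
  have htw : ∀ i, t i w = t i (e i) * e.coord i w := fun i => by
    conv_lhs => rw [hts i]
    rfl
  have htw0 : ∀ i, t i w ≠ 0 := fun i => by
    rw [htw]
    exact mul_ne_zero (Finset.prod_ne_zero_iff.1 hprod0 i (Finset.mem_univ i))
      (hw0 i (Finset.mem_univ i))
  refine ⟨htw0, ?_⟩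
  rw [eq_div_iff (Finset.prod_ne_zero_iff.2 fun i _ => htw0 i), ← hmain, hmult,
    Finset.prod_congr rfl fun i _ => htw i, Finset.prod_mul_distrib, ← mul_assoc]
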